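/- A box $b$ of the Young diagram of a partition has as its hook the set consisting of $b$, the boxes to the right of $b$ in its row, and the boxes below $b$ in its column; the hooklength of $b$ is the number of boxes in its hook. A partition is a $3$-core if none of its hooklengths equals $3$. For $n\ge 0$ let $a_3(n)$ be the number of $3$-core partitions of $n$. For a prime $p$ let $\nu_p$ denote the $p$-adic valuation. Let $k$ be a positive integer with $3\nmid k$. (1) Let $m$ be the product, counted with multiplicity, of the prime factors of $k$ that are congruent to $2$ modulo $3$, and assume that $m$ is a perfect square. Then $k\equiv 1\pmod 3$ and, for every integer $n\ge 0$, $$a_3\left(kn+\frac{k-1}{3}\right)=a_3(n)\prod_{p\equiv 1\,(\mathrm{mod}\ 3)}\frac{\nu_p(k)+\nu_p(3n+1)+1}{\nu_p(3n+1)+1},$$ where the product runs over all primes $p\equiv 1\pmod 3$ and only finitely many of its factors differ from $1$. (2) In particular, if $k$ is a perfect square with no prime factor congruent to $1$ modulo $3$, then $k\equiv 1\pmod 3$ and $a_3\left(kn+\frac{k-1}{3}\right)=a_3(n)$ for every integer $n\ge 0$. -/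

import Mathlib

namespace ThreeCore

/-- The Young diagram of a partition: row `j` (counted from `0`, top to bottom) has as many boxes
as the `j`-th largest part. -/
def diagram {n : ℕ} (p : n.Partition) : YoungDiagram :=
  YoungDiagram.ofRowLens (p.parts.sort (· ≥ ·)) (p.parts.pairwise_sort (· ≥ ·)).sortedGE

/-- The hook of the box `b` in a Young diagram: the box `b` itself, the boxes to its right
in the same row, and the boxes below it in the same column. -/
def hook (μ : YoungDiagram) (b : ℕ × ℕ) : Finset (ℕ × ℕ) :=
  μ.cells.filter fun c => (c.1 = b.1 ∧ b.2 ≤ c.2) ∨ (c.2 = b.2 ∧ b.1 ≤ c.1)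

/-- The hooklength of the box `b`: the number of boxes of its hook. -/
def hookLength (μ : YoungDiagram) (b : ℕ × ℕ) : ℕ :=
  (hook μ b).card

/-- A partition is a `3`-core if no box of its Young diagram has hooklength `3`. -/
def IsThreeCore {n : ℕ} (p : n.Partition) : Prop :=
  ∀ b ∈ (diagram p).cells, hookLength (diagram p) b ≠ 3

instance {n : ℕ} : DecidablePred (IsThreeCore (n := n)) := fun p =>
  inferInstanceAs (Decidable (∀ b ∈ (diagram p).cells, hookLength (diagram p) b ≠ 3))

/-- The number `a₃(n)` of `3`-core partitions of `n`. -/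
def a₃ (n : ℕ) : ℕ :=
  (Finset.univ.filter fun p : n.Partition => IsThreeCore p).card

/-- The set of primes congruent to `1` modulo `3`. -/
def primesOneModThree : Set ℕ :=
  {p | p.Prime ∧ p ≡ 1 [MOD 3]}

/-- The product, with multiplicity, of the prime factors of `k` congruent to `2` modulo `3`. -/
def twoModThreePart (k : ℕ) : ℕ :=
  (k.primeFactorsList.filter fun p => p ≡ 2 [MOD 3]).prod

/-- The factor `(ν_p(k) + ν_p(3n+1) + 1) / (ν_p(3n+1) + 1)`. -/
def factor (k n p : ℕ) : ℚ :=
  ((padicValNat p k + padicValNat p (3 * n + 1) + 1 : ℕ) : ℚ) /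
    ((padicValNat p (3 * n + 1) + 1 : ℕ) : ℚ)

end ThreeCore

/-! Let `r(m)` be the number of Eisenstein integers `x + yω`, `ω² + ω + 1 = 0`, of norm `x² - xy +
y² = m`. Two facts carry the proof. A 3-core is coded by a pair `(a, b)` of naturals with size `a² -
ab + b² + b`; completing the square turns such pairs into one sixth of the points of norm `3n + 1`,
so `r(3n + 1) = 6 a₃(n)` (`ncard_normSet_eq`). For a prime `p ≡ 1 (mod 3)`, `p` splits, and `r(p^e
m) = (e + 1) r(m)` when `p ∤ m`; a prime `q ≡ 2` is inert, and `r(q² M) = r(M)`. Since `3(kn + (k -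
1)/3) + 1 = k(3n + 1)`, it remains to multiply by the prime factors of `k` one at a time, the inert
ones in pairs; the ratios telescope (`ScalesNormCount.mul`). -/

namespace ThreeCore

/-! ### Counting Eisenstein integers of given norm -/

/-- The integer points `(x, y)` at which the Eisenstein norm form takes the value `m`. -/
def normSet (m : ℤ) : Set (ℤ × ℤ) :=
  {z | z.1 ^ 2 - z.1 * z.2 + z.2 ^ 2 = m}

theorem mem_normSet {m : ℤ} {z : ℤ × ℤ} :
    z ∈ normSet m ↔ z.1 ^ 2 - z.1 * z.2 + z.2 ^ 2 = m := Iff.rfl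

theorem normSet_finite (m : ℤ) : (normSet m).Finite := by
  refine ((Set.finite_Icc (-2 * m) (2 * m)).prod (Set.finite_Icc (-2 * m) (2 * m))).subset ?_
  rintro ⟨x, y⟩ h
  rw [mem_normSet] at h
  simp only at h
  -- Four times the form is `3x² + (2y - x)²`, and symmetrically in `y`.
  have hx : 3 * x ^ 2 ≤ 4 * m := by nlinarith [sq_nonneg (2 * y - x)]
  have hy : 3 * y ^ 2 ≤ 4 * m := by nlinarith [sq_nonneg (2 * x - y)]
  have h1 := Int.le_self_sq x
  have h2 := Int.le_self_sq (-x)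
  have h3 := Int.le_self_sq y
  have h4 := Int.le_self_sq (-y)
  have h5 := sq_nonneg x
  simp only [neg_sq] at h2 h4
  simp only [Set.mem_prod, Set.mem_Icc]
  refine ⟨⟨?_, ?_⟩, ?_, ?_⟩ <;> linarith

/-- Among the points of norm `p * M`, those in the prime ideal generated by an element of
norm `p` are as many as the points of norm `M`. -/
theorem ncard_normSet_mul_of_dvd {p c d t M : ℤ} (hp : p ≠ 0)
    (hn : c ^ 2 - c * d + d ^ 2 = p) (ht : p ∣ t ^ 2 + t + 1) (hc : p ∣ c + d * t) :
    {z ∈ normSet (p * M) | p ∣ z.1 + z.2 * t}.ncard = (normSet M).ncard := by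
  -- The map is multiplication by `c + dω`; the condition `p ∣ x + yt` says that `x + yω` vanishes
  -- under `ω ↦ t` modulo `p`.
  have himg : {z ∈ normSet (p * M) | p ∣ z.1 + z.2 * t} =
      (fun w : ℤ × ℤ => (c * w.1 - d * w.2, c * w.2 + d * w.1 - d * w.2)) '' normSet M := by
    ext ⟨x, y⟩
    simp only [Set.mem_ofPred_eq, mem_normSet, Set.mem_image, Prod.exists, Prod.mk.injEq]
    constructor
    · rintro ⟨h, k, hk⟩
      obtain ⟨e, he⟩ := hc
      obtain ⟨f, hf⟩ := ht
      have hx : x = p * k - y * t := by linarith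
      have hc' : c = p * e - d * t := by linarith
      -- These are the coordinates of `x + yω` times the conjugate `(c - d) - dω`; dividing them by
      -- `p` inverts the map.
      have h1 : p ∣ x * (c - d) + y * d :=
        ⟨k * (c - d) - y * t * e + y * d * f, by
          rw [hx, hc']; linear_combination y * d * hf⟩
      have h2 : p ∣ y * c - x * d := ⟨y * e - k * d, by rw [hx, hc']; ring⟩
      obtain ⟨u, hu⟩ := h1
      obtain ⟨v, hv⟩ := h2
      have e1 : c * u - d * v = x := by
        apply mul_left_cancel₀ hp
        linear_combination -c * hu + d * hv + x * hn
      have e2 : c * v + d * u - d * v = y := by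
        apply mul_left_cancel₀ hp
        linear_combination -c * hv - d * hu + d * hv + y * hn
      refine ⟨u, v, ?_, e1, e2⟩
      apply mul_left_cancel₀ hp
      rw [← h, ← e1, ← e2, ← hn]
      ring
    · rintro ⟨u, v, h, rfl, rfl⟩
      refine ⟨by rw [← h, ← hn]; ring, ?_⟩
      obtain ⟨e, he⟩ := hc
      obtain ⟨f, hf⟩ := ht
      have hc' : c = p * e - d * t := by linarith
      refine ⟨e * u + e * v * t - d * v * f, ?_⟩
      rw [hc']
      linear_combination -d * v * hf
  rw [himg]
  apply Set.ncard_image_of_injective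
  rintro ⟨x, y⟩ ⟨x', y'⟩ h
  simp only [Prod.mk.injEq] at h ⊢
  obtain ⟨h1, h2⟩ := h
  constructor
  · apply mul_left_cancel₀ hp
    rw [← hn]
    linear_combination (c - d) * h1 + d * h2
  · apply mul_left_cancel₀ hp
    rw [← hn]
    linear_combination c * h2 - d * h1

theorem ncard_normSet_sq_mul {q M : ℤ} (hq : q ≠ 0) :
    {z ∈ normSet (q * (q * M)) | q ∣ z.1 ∧ q ∣ z.2}.ncard = (normSet M).ncard := by
  have himg : {z ∈ normSet (q * (q * M)) | q ∣ z.1 ∧ q ∣ z.2} =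
      (fun w : ℤ × ℤ => (q * w.1, q * w.2)) '' normSet M := by
    ext ⟨x, y⟩
    simp only [Set.mem_ofPred_eq, mem_normSet, Set.mem_image, Prod.exists, Prod.mk.injEq]
    constructor
    · rintro ⟨h, ⟨u, rfl⟩, v, rfl⟩
      refine ⟨u, v, ?_, rfl, rfl⟩
      apply mul_left_cancel₀ hq
      apply mul_left_cancel₀ hq
      linear_combination h
    · rintro ⟨u, v, h, rfl, rfl⟩
      exact ⟨by rw [← h]; ring, dvd_mul_right _ _, dvd_mul_right _ _⟩
  rw [himg]
  apply Set.ncard_image_of_injective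
  rintro ⟨x, y⟩ ⟨x', y'⟩ h
  simp only [Prod.mk.injEq] at h ⊢
  exact ⟨mul_left_cancel₀ hq h.1, mul_left_cancel₀ hq h.2⟩

/-- A primitive cube root of unity modulo a prime `p ≡ 1 (mod 3)`. -/
theorem exists_dvd_sq_add_self_add_one {p : ℕ} (hp : p.Prime) (h1 : p ≡ 1 [MOD 3]) :
    ∃ t : ℤ, (p : ℤ) ∣ t ^ 2 + t + 1 := by
  have : Fact p.Prime := ⟨hp⟩
  have : Fact (Nat.Prime 3) := ⟨Nat.prime_three⟩
  have hcard : 3 ∣ Fintype.card (ZMod p)ˣ := by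
    rw [ZMod.card_units]
    exact (Nat.modEq_iff_dvd' hp.one_le).1 h1.symm
  obtain ⟨u, hu⟩ := exists_prime_orderOf_dvd_card 3 hcard
  have hne : (u : ZMod p) ≠ 1 := by
    intro h
    rw [Units.val_eq_one.1 h, orderOf_one] at hu
    omega
  have h3 : (u : ZMod p) ^ 3 = 1 := by
    rw [← Units.val_pow_eq_pow_val, ← hu, pow_orderOf_eq_one, Units.val_one]
  have hroot : (u : ZMod p) ^ 2 + u + 1 = 0 := by
    have : ((u : ZMod p) - 1) * ((u : ZMod p) ^ 2 + u + 1) = 0 := by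
      linear_combination h3
    exact (mul_eq_zero.1 this).resolve_left (sub_ne_zero.2 hne)
  refine ⟨((u : ZMod p).val : ℤ), ?_⟩
  rw [← ZMod.intCast_zmod_eq_zero_iff_dvd]
  push_cast
  rw [ZMod.natCast_zmod_val]
  exact hroot

/-- Thue's lemma. -/
theorem exists_small_dvd_add_mul {p : ℕ} (hp : p.Prime) (t : ℤ) :
    ∃ x y : ℤ, (x ≠ 0 ∨ y ≠ 0) ∧ x ^ 2 < p ∧ y ^ 2 < p ∧ (p : ℤ) ∣ x + y * t := by
  have : Fact p.Prime := ⟨hp⟩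
  set k := Nat.sqrt p with hk
  have hlt : p < (k + 1) * (k + 1) := Nat.lt_succ_sqrt p
  have hsq : k * k < p := by
    refine lt_of_le_of_ne (Nat.sqrt_le p) fun h => ?_
    exact hp.prime.not_isSquare ⟨k, h.symm⟩
  -- Pigeonhole: `(k + 1)²` pairs exceed the `p` residues, so two pairs agree and their difference
  -- is the wanted vector.
  obtain ⟨⟨a, b⟩, hab, ⟨a', b'⟩, hab', hne, heq⟩ :=
    Finset.exists_ne_map_eq_of_card_lt_of_maps_to
      (s := Finset.range (k + 1) ×ˢ Finset.range (k + 1)) (t := (Finset.univ : Finset (ZMod p)))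
      (f := fun z => (z.1 : ZMod p) + (z.2 : ZMod p) * (t : ZMod p))
      (by simpa [ZMod.card] using hlt) (fun _ _ => Finset.mem_univ _)
  simp only [Finset.mem_product, Finset.mem_range] at hab hab'
  have hbound : ∀ u v : ℕ, u < k + 1 → v < k + 1 → ((u : ℤ) - v) ^ 2 < p := by
    intro u v hu hv
    have hkp : (k : ℤ) * k < p := by exact_mod_cast hsq
    have h1 : (u : ℤ) ≤ k := by omega
    have h2 : (v : ℤ) ≤ k := by omega
    have h3 : (0 : ℤ) ≤ u := by omega
    have h4 : (0 : ℤ) ≤ v := by omega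
    nlinarith [mul_nonneg (by linarith : (0 : ℤ) ≤ k - (u - v)) (by linarith : (0 : ℤ) ≤ k + (u - v))]
  refine ⟨a - a', b - b', ?_, hbound _ _ hab.1 hab'.1, hbound _ _ hab.2 hab'.2, ?_⟩
  · by_contra! h
    apply hne
    ext <;> simp <;> omega
  · rw [← ZMod.intCast_zmod_eq_zero_iff_dvd]
    push_cast
    simp only at heq
    linear_combination heq

theorem even_of_even_norm {x y : ℤ} (h : 2 ∣ x ^ 2 - x * y + y ^ 2) : 2 ∣ x ∧ 2 ∣ y := by
  rcases Int.even_or_odd' x with ⟨a, rfl | rfl⟩ <;> rcases Int.even_or_odd' y with ⟨b, rfl | rfl⟩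
  · exact ⟨dvd_mul_right _ _, dvd_mul_right _ _⟩
  all_goals
    exfalso
    ring_nf at h
    omega

/-- Thue's vector has positive norm divisible by `p` and below `3p`. Norm `2p` would make both
coordinates even, hence `p` even. -/
theorem exists_norm_eq {p : ℕ} (hp : p.Prime) (hp2 : p ≠ 2) {t : ℤ}
    (ht : (p : ℤ) ∣ t ^ 2 + t + 1) :
    ∃ c d : ℤ, c ^ 2 - c * d + d ^ 2 = p ∧ (p : ℤ) ∣ c + d * t := by
  obtain ⟨x, y, hne, hx, hy, hd⟩ := exists_small_dvd_add_mul hp t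
  refine ⟨x, y, ?_, hd⟩
  have hdvd : (p : ℤ) ∣ x ^ 2 - x * y + y ^ 2 := by
    obtain ⟨k, hk⟩ := hd
    obtain ⟨f, hf⟩ := ht
    have hx : x = p * k - y * t := by linarith
    refine ⟨p * k ^ 2 - 2 * k * y * t - k * y + y ^ 2 * f, ?_⟩
    rw [hx]
    linear_combination y ^ 2 * hf
  have hpos : 0 < x ^ 2 - x * y + y ^ 2 := by
    rcases hne with h | h
    · nlinarith [sq_nonneg (2 * y - x), sq_pos_of_ne_zero h]
    · nlinarith [sq_nonneg (2 * x - y), sq_pos_of_ne_zero h]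
  have hlt : x ^ 2 - x * y + y ^ 2 < 3 * p := by nlinarith [sq_nonneg (x + y)]
  obtain ⟨m, hm⟩ := hdvd
  have hp0 : (0 : ℤ) < p := by exact_mod_cast hp.pos
  have hm0 : 0 < m := by
    by_contra! h
    nlinarith
  have hm3 : m < 3 := by
    by_contra! h
    nlinarith
  have hm12 : m = 1 ∨ m = 2 := by omega
  rcases hm12 with rfl | rfl
  · linarith
  · exfalso
    obtain ⟨⟨a, rfl⟩, b, rfl⟩ := even_of_even_norm (x := x) (y := y) ⟨p, by linarith⟩
    have h2 : (2 : ℤ) ∣ p := ⟨a ^ 2 - a * b + b ^ 2, by linarith⟩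
    have h2' : 2 ∣ p := by exact_mod_cast h2
    exact hp2 ((Nat.prime_dvd_prime_iff_eq Nat.prime_two hp).1 h2').symm

/-- The recursion for the number of points of norm `p * M`, for a split prime `p`. -/
theorem ncard_normSet_split_mul_add {p : ℕ} (hp : p.Prime) (h1 : p ≡ 1 [MOD 3]) (M : ℤ) :
    (normSet (p * M)).ncard + {z ∈ normSet (p * M) | (p : ℤ) ∣ z.1 ∧ (p : ℤ) ∣ z.2}.ncard =
      2 * (normSet M).ncard := by
  have hp0 : (p : ℤ) ≠ 0 := by exact_mod_cast hp.ne_zero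
  have hpi : Prime (p : ℤ) := Nat.prime_iff_prime_int.1 hp
  have hp2 : p ≠ 2 := by rintro rfl; exact absurd h1 (by decide)
  have hp3 : p ≠ 3 := by rintro rfl; exact absurd h1 (by decide)
  obtain ⟨t, ht⟩ := exists_dvd_sq_add_self_add_one hp h1
  obtain ⟨c, d, hn, hc⟩ := exists_norm_eq hp hp2 ht
  have hA := ncard_normSet_mul_of_dvd (M := M) hp0 hn ht hc
  -- The conjugate prime `(c - d) - dω`, with the other root `-1 - t`.
  have hB := ncard_normSet_mul_of_dvd (p := p) (c := c - d) (d := -d) (t := -1 - t) (M := M) hp0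
    (by rw [← hn]; ring) (by convert ht using 1; ring) (by convert hc using 1; ring)
  set A := {z ∈ normSet (p * M) | (p : ℤ) ∣ z.1 + z.2 * t}
  set B := {z ∈ normSet (p * M) | (p : ℤ) ∣ z.1 + z.2 * (-1 - t)}
  have hU : A ∪ B = normSet (p * M) := by
    ext ⟨x, y⟩
    constructor
    · rintro (h | h) <;> exact h.1
    · intro h
      -- Modulo `p` the norm factors through the two roots.
      have hdvd : (p : ℤ) ∣ (x + y * t) * (x + y * (-1 - t)) := by
        rw [mem_normSet] at h
        obtain ⟨f, hf⟩ := ht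
        exact ⟨M - y ^ 2 * f, by simp only at h; linear_combination h - y ^ 2 * hf⟩
      rcases hpi.dvd_or_dvd hdvd with h' | h'
      · exact Or.inl ⟨h, h'⟩
      · exact Or.inr ⟨h, h'⟩
  have hI : A ∩ B = {z ∈ normSet (p * M) | (p : ℤ) ∣ z.1 ∧ (p : ℤ) ∣ z.2} := by
    ext ⟨x, y⟩
    constructor
    · rintro ⟨⟨h, ha⟩, -, hb⟩
      simp only at ha hb
      have hy : (p : ℤ) ∣ y := by
        -- The difference of the two linear forms is `y(2t + 1)`, and `(2t + 1)² ≡ -3` modulo `p`.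
        have h3 : (p : ℤ) ∣ y * (3 : ℤ) := by
          obtain ⟨a, ha⟩ := ha
          obtain ⟨b, hb⟩ := hb
          obtain ⟨f, hf⟩ := ht
          exact ⟨4 * y * f - (a - b) * (2 * t + 1), by
            linear_combination 4 * y * hf - (2 * t + 1) * (ha - hb)⟩
        refine (hpi.dvd_or_dvd h3).resolve_right fun h => hp3 ?_
        have h' : p ∣ 3 := by exact_mod_cast h
        exact (Nat.prime_dvd_prime_iff_eq hp Nat.prime_three).1 h'
      exact ⟨h, (dvd_add_left (hy.mul_right t)).1 ha, hy⟩
    · rintro ⟨h, ha, hb⟩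
      exact ⟨⟨h, dvd_add ha (hb.mul_right _)⟩, h, dvd_add ha (hb.mul_right _)⟩
  have hfin : ∀ s : Set (ℤ × ℤ), s ⊆ normSet (p * M) → s.Finite :=
    fun s hs => (normSet_finite _).subset hs
  have := Set.ncard_union_add_ncard_inter A B (hfin A fun _ h => h.1) (hfin B fun _ h => h.1)
  rw [hU, hI] at this
  omega

theorem ncard_normSet_split_mul_mul {p : ℕ} (hp : p.Prime) (h1 : p ≡ 1 [MOD 3]) (M : ℤ) :
    (normSet (p * (p * M))).ncard + (normSet M).ncard = 2 * (normSet (p * M)).ncard := by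
  rw [← ncard_normSet_split_mul_add hp h1 (p * M),
    ncard_normSet_sq_mul (by exact_mod_cast hp.ne_zero)]

theorem ncard_normSet_split_mul_of_not_dvd {p : ℕ} (hp : p.Prime) (h1 : p ≡ 1 [MOD 3]) {M : ℤ}
    (hM : ¬ (p : ℤ) ∣ M) : (normSet (p * M)).ncard = 2 * (normSet M).ncard := by
  rw [← ncard_normSet_split_mul_add hp h1 M]
  have : {z ∈ normSet (p * M) | (p : ℤ) ∣ z.1 ∧ (p : ℤ) ∣ z.2} = ∅ := by
    rw [Set.eq_empty_iff_forall_notMem]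
    rintro ⟨x, y⟩ ⟨h, ⟨a, ha⟩, b, hb⟩
    rw [mem_normSet] at h
    simp only at ha hb h
    subst ha hb
    refine hM ⟨a ^ 2 - a * b + b ^ 2, ?_⟩
    apply mul_left_cancel₀ (by exact_mod_cast hp.ne_zero : (p : ℤ) ≠ 0)
    linear_combination -h
  rw [this, Set.ncard_empty, add_zero]

/-- The two-step recursion makes the counts an arithmetic progression in `e`, with first terms
`r(m)` and `2 r(m)`. -/
theorem ncard_normSet_split_pow_mul {p : ℕ} (hp : p.Prime) (h1 : p ≡ 1 [MOD 3]) {m : ℤ}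
    (hm : ¬ (p : ℤ) ∣ m) (e : ℕ) :
    (normSet (p ^ e * m)).ncard = (e + 1) * (normSet m).ncard := by
  induction e using Nat.twoStepInduction with
  | zero => simp
  | one => simpa using ncard_normSet_split_mul_of_not_dvd hp h1 hm
  | more e h0 h1' =>
    have h := ncard_normSet_split_mul_mul hp h1 (p ^ e * m)
    rw [← mul_assoc (p : ℤ) (p ^ e) m, ← pow_succ', ← mul_assoc (p : ℤ) (p ^ (e + 1)) m,
      ← pow_succ', h0, h1'] at h
    linarith

theorem ncard_normSet_split_mul {p : ℕ} (hp : p.Prime) (h1 : p ≡ 1 [MOD 3]) {M : ℕ} (hM : 0 < M) :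
    (normSet (p * M : ℕ)).ncard * (padicValNat p M + 1) =
      (normSet M).ncard * (padicValNat p M + 2) := by
  have : Fact p.Prime := ⟨hp⟩
  obtain ⟨e, m, hm, rfl⟩ := Nat.exists_eq_pow_mul_and_not_dvd hM.ne' p hp.ne_one
  have hm' : ¬ (p : ℤ) ∣ m := by exact_mod_cast hm
  have hm0 : m ≠ 0 := by rintro rfl; exact hm (dvd_zero p)
  have hv : padicValNat p (p ^ e * m) = e := by
    rw [padicValNat.mul (pow_ne_zero _ hp.ne_zero) hm0, padicValNat.prime_pow,
      padicValNat.eq_zero_of_not_dvd hm, add_zero]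
  have h := ncard_normSet_split_pow_mul hp h1 hm' e
  have h' := ncard_normSet_split_pow_mul hp h1 hm' (e + 1)
  rw [hv, ← mul_assoc, ← pow_succ']
  push_cast
  rw [h, h']
  ring

/-- If `q ∤ y`, then `-x/y` is a primitive cube root of unity modulo `q`, which forces `3 ∣ q - 1`.
-/
theorem dvd_of_dvd_norm {q : ℕ} (hq : q.Prime) (h2 : q ≡ 2 [MOD 3]) {x y : ℤ}
    (h : (q : ℤ) ∣ x ^ 2 - x * y + y ^ 2) : (q : ℤ) ∣ x ∧ (q : ℤ) ∣ y := by
  have : Fact q.Prime := ⟨hq⟩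
  have hq3 : q ≠ 3 := by rintro rfl; exact absurd h2 (by decide)
  simp only [← ZMod.intCast_zmod_eq_zero_iff_dvd] at h ⊢
  push_cast at h
  by_cases hy : (y : ZMod q) = 0
  · rw [hy] at h
    exact ⟨by simpa using h, hy⟩
  exfalso
  set s : ZMod q := -(x * (y : ZMod q)⁻¹) with hs
  have hxy : (x : ZMod q) = -s * y := by
    rw [hs]; field_simp
  have hroot : s ^ 2 + s + 1 = 0 := by
    rw [hxy] at h
    have : (y : ZMod q) ^ 2 * (s ^ 2 + s + 1) = 0 := by linear_combination h
    exact (mul_eq_zero.1 this).resolve_left (pow_ne_zero _ hy)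
  have hs3 : s ^ 3 = 1 := by linear_combination (s - 1) * hroot
  have hs1 : s ≠ 1 := by
    intro h1
    rw [h1] at hroot
    have h3 : ((3 : ℕ) : ZMod q) = 0 := by push_cast; linear_combination hroot
    rw [ZMod.natCast_eq_zero_iff] at h3
    exact hq3 ((Nat.prime_dvd_prime_iff_eq hq Nat.prime_three).1 h3)
  have : Fact (Nat.Prime 3) := ⟨Nat.prime_three⟩
  have hord : orderOf s = 3 := orderOf_eq_prime hs3 hs1
  have hs0 : s ≠ 0 := by rintro h0; rw [h0] at hroot; simp at hroot
  have hd : 3 ∣ q - 1 := by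
    rw [← hord]
    exact orderOf_dvd_of_pow_eq_one (ZMod.pow_card_sub_one_eq_one hs0)
  have := hq.one_le
  have h2' : q % 3 = 2 := h2
  omega

theorem ncard_normSet_inert_sq_mul {q : ℕ} (hq : q.Prime) (h2 : q ≡ 2 [MOD 3]) (M : ℕ) :
    (normSet (q * q * M : ℕ)).ncard = (normSet M).ncard := by
  rw [← ncard_normSet_sq_mul (q := q) (M := M) (by exact_mod_cast hq.ne_zero)]
  congr 1
  ext ⟨x, y⟩
  simp only [Set.mem_ofPred_eq, mem_normSet]
  push_cast
  rw [mul_assoc]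
  refine ⟨fun h => ⟨h, dvd_of_dvd_norm hq h2 ⟨_, h⟩⟩, fun h => h.1⟩

/-! ### Hooks of length 3 in terms of row lengths -/

theorem hookLength_eq {μ : YoungDiagram} {i j : ℕ} (h : (i, j) ∈ μ) :
    hookLength μ (i, j) = (μ.rowLen i - j) + (μ.colLen j - (i + 1)) := by
  have hrow := YoungDiagram.mem_iff_lt_rowLen.1 h
  have hcol := YoungDiagram.mem_iff_lt_colLen.1 h
  have hunion : hook μ (i, j) =
      ({i} ×ˢ Finset.Ico j (μ.rowLen i)) ∪ (Finset.Ico (i + 1) (μ.colLen j) ×ˢ {j}) := by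
    ext ⟨a, b⟩
    simp only [hook, Finset.mem_filter, YoungDiagram.mem_cells, Finset.mem_union,
      Finset.mem_product, Finset.mem_singleton, Finset.mem_Ico]
    constructor
    · rintro ⟨hm, ⟨rfl, hb⟩ | ⟨rfl, ha⟩⟩
      · exact Or.inl ⟨rfl, hb, YoungDiagram.mem_iff_lt_rowLen.1 hm⟩
      · rcases ha.eq_or_lt with rfl | ha
        · exact Or.inl ⟨rfl, le_rfl, hrow⟩
        · exact Or.inr ⟨⟨ha, YoungDiagram.mem_iff_lt_colLen.1 hm⟩, rfl⟩
    · rintro (⟨rfl, hb, hb'⟩ | ⟨⟨ha, ha'⟩, rfl⟩)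
      · exact ⟨YoungDiagram.mem_iff_lt_rowLen.2 hb', Or.inl ⟨rfl, hb⟩⟩
      · exact ⟨YoungDiagram.mem_iff_lt_colLen.2 ha', Or.inr ⟨rfl, by omega⟩⟩
  have hdisj : Disjoint ({i} ×ˢ Finset.Ico j (μ.rowLen i))
      (Finset.Ico (i + 1) (μ.colLen j) ×ˢ {j}) := by
    rw [Finset.disjoint_left]
    rintro ⟨a, b⟩ h1 h2
    simp only [Finset.mem_product, Finset.mem_singleton, Finset.mem_Ico] at h1 h2
    omega
  rw [hookLength, hunion, Finset.card_union_of_disjoint hdisj]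
  simp

/-- The condition on the row lengths `f` that the diagram has no hook of length `3`: the three
parts exclude the hooks with two, one and no boxes below their corner. -/
def NoThreeHook (f : ℕ → ℕ) : Prop :=
  ∀ i, ¬ (0 < f i ∧ f i ≤ f (i + 2) ∧ f (i + 3) < f i) ∧
    ¬ (2 ≤ f i ∧ f i ≤ f (i + 1) + 1 ∧ f (i + 2) + 1 < f i) ∧
    ¬ (3 ≤ f i ∧ f (i + 1) + 2 < f i)

theorem forall_hookLength_ne_three_iff (μ : YoungDiagram) :
    (∀ b ∈ μ.cells, hookLength μ b ≠ 3) ↔ NoThreeHook μ.rowLen := by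
  have key : ∀ i j, j < μ.rowLen i ↔ i < μ.colLen j := fun i j =>
    YoungDiagram.mem_iff_lt_rowLen.symm.trans YoungDiagram.mem_iff_lt_colLen
  constructor
  · intro h i
    have hook_ne : ∀ j, j < μ.rowLen i → (μ.rowLen i - j) + (μ.colLen j - (i + 1)) ≠ 3 := by
      intro j hj
      have hm : (i, j) ∈ μ := YoungDiagram.mem_iff_lt_rowLen.2 hj
      rw [← hookLength_eq hm]
      exact h _ hm
    refine ⟨?_, ?_, ?_⟩
    -- With two boxes below it, the corner of a 3-hook is the last box of its row; with one or none,
    -- it is the second or third from the end.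
    · rintro ⟨h0, h2, h3⟩
      have := hook_ne (μ.rowLen i - 1) (by omega)
      have := key (i + 2) (μ.rowLen i - 1)
      have := key (i + 3) (μ.rowLen i - 1)
      omega
    · rintro ⟨h0, h2, h3⟩
      have := hook_ne (μ.rowLen i - 2) (by omega)
      have := key (i + 1) (μ.rowLen i - 2)
      have := key (i + 2) (μ.rowLen i - 2)
      omega
    · rintro ⟨h0, h2⟩
      have := hook_ne (μ.rowLen i - 3) (by omega)
      have := key i (μ.rowLen i - 3)
      have := key (i + 1) (μ.rowLen i - 3)
      omega
  · rintro h ⟨i, j⟩ hm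
    rw [hookLength_eq hm]
    have hj : j < μ.rowLen i := YoungDiagram.mem_iff_lt_rowLen.1 hm
    obtain ⟨h1, h2, h3⟩ := h i
    have k0 := key i j
    have k1 := key (i + 1) j
    have k2 := key (i + 2) j
    have k3 := key (i + 3) j
    omega

theorem rowLen_ofRowLens_eq_getD (w : List ℕ) (hw : w.SortedGE) (i : ℕ) :
    (YoungDiagram.ofRowLens w hw).rowLen i = w.getD i 0 := by
  by_cases hi : i < w.length
  · rw [List.getD_eq_getElem _ _ hi]
    exact YoungDiagram.rowLen_ofRowLens ⟨i, hi⟩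
  · rw [List.getD_eq_default _ _ (by omega)]
    by_contra! h
    have hm := YoungDiagram.mem_iff_lt_rowLen.2 (Nat.pos_of_ne_zero h)
    rw [YoungDiagram.mem_ofRowLens] at hm
    exact hi hm.1

/-! ### Shape and size of the 3-cores -/

/-- The partition with parts `⌈r / 2⌉, …, 2, 2, 1, 1`, in `r` rows. -/
def staircase : ℕ → List ℕ
  | 0 => []
  | r + 1 => (r / 2 + 1) :: staircase r

/-- The partition that arises from `staircase r` by adding on top `s` rows, each longer by `2` than
the row below it. -/
def stairs (r : ℕ) : ℕ → List ℕ
  | 0 => staircase r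
  | s + 1 => ((r + 1) / 2 + 2 * (s + 1)) :: stairs r s

/-- For `i ≥ r`, truncated subtraction gives `1 / 2 = 0`, matching the default value. -/
theorem getD_staircase (r i : ℕ) : (staircase r).getD i 0 = (r - i + 1) / 2 := by
  induction r generalizing i with
  | zero => simp [staircase]
  | succ r ih =>
    cases i with
    | zero => simp only [staircase, List.getD_cons_zero]; omega
    | succ i => rw [staircase, List.getD_cons_succ, ih]; congr 2; omega

theorem getD_stairs (r s i : ℕ) : (stairs r s).getD i 0 =
    if i < s then (r + 1) / 2 + 2 * (s - i) else (r - (i - s) + 1) / 2 := by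
  induction s generalizing i with
  | zero => rw [stairs, getD_staircase]; simp
  | succ s ih =>
    cases i with
    | zero => simp [stairs]
    | succ i => rw [stairs, List.getD_cons_succ, ih]; simp

theorem mem_stairs {r s x : ℕ} (hx : x ∈ stairs r s) : 0 < x ∧ x ≤ (r + 1) / 2 + 2 * s := by
  induction s with
  | zero =>
    rw [stairs] at hx
    induction r with
    | zero => simp [staircase] at hx
    | succ r ih =>
      rw [staircase, List.mem_cons] at hx
      rcases hx with rfl | hx
      · omega
      · have := ih hx
        omega
  | succ s ih =>
    rw [stairs, List.mem_cons] at hx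
    rcases hx with rfl | hx
    · omega
    · have := ih hx
      omega

theorem pairwise_stairs (r s : ℕ) : (stairs r s).Pairwise (· ≥ ·) := by
  induction s with
  | zero =>
    rw [stairs]
    induction r with
    | zero => exact List.Pairwise.nil
    | succ r ih =>
      refine List.Pairwise.cons (fun x hx => ?_) ih
      have := (mem_stairs (s := 0) hx).2
      omega
  | succ s ih =>
    refine List.Pairwise.cons (fun x hx => ?_) ih
    have := (mem_stairs hx).2
    omega

theorem noThreeHook_stairs (r s : ℕ) : NoThreeHook fun i => (stairs r s).getD i 0 := by
  intro i
  simp only [getD_stairs]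
  refine ⟨?_, ?_, ?_⟩
  all_goals
    split_ifs <;> omega

/-- Deleting the top row preserves the condition, so the diagram grows from the bottom. On a pure
staircase a new top row has two possible lengths, prolonging the staircase or exceeding its top row
by `2`; after one step of `2`, only steps of `2` remain. -/
theorem exists_eq_stairs {l : List ℕ} (hl : l.Pairwise (· ≥ ·)) (hpos : ∀ x ∈ l, 0 < x)
    (h : NoThreeHook fun i => l.getD i 0) : ∃ r s, l = stairs r s := by
  induction l with
  | nil => exact ⟨0, 0, rfl⟩
  | cons x t ih =>
    rw [List.pairwise_cons] at hl
    obtain ⟨r, s, rfl⟩ := ih hl.2 (fun y hy => hpos y (List.mem_cons_of_mem _ hy))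
      fun i => by simpa using h (i + 1)
    have hx := hpos x List.mem_cons_self
    have hge : (stairs r s).getD 0 0 ≤ x := by
      by_cases h0 : 0 < (stairs r s).length
      · rw [List.getD_eq_getElem _ _ h0]
        exact hl.1 _ (List.getElem_mem h0)
      · rw [List.getD_eq_default _ _ (by omega)]
        exact Nat.zero_le x
    have h0 := h 0
    simp only [zero_add, List.getD_cons_zero, List.getD_cons_succ] at h0
    simp only [getD_stairs] at h0 hge
    cases s with
    | zero =>
      have hcases : x = (r + 1) / 2 + 2 * (0 + 1) ∨ x = r / 2 + 1 := by
        simp only [Nat.not_lt_zero, if_false] at h0 hge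
        omega
      rcases hcases with rfl | rfl
      · exact ⟨r, 1, rfl⟩
      · exact ⟨r + 1, 0, rfl⟩
    | succ s =>
      refine ⟨r, s + 2, ?_⟩
      rw [stairs]
      congr 1
      split_ifs at h0 hge <;> omega

theorem length_stairs (r s : ℕ) : (stairs r s).length = r + s := by
  induction s with
  | zero =>
    rw [stairs]
    induction r with
    | zero => rfl
    | succ r ih => rw [staircase, List.length_cons, ih]
  | succ s ih => rw [stairs, List.length_cons, ih, add_assoc]

/-- The number of rows gives `r + s`; for fixed `r + s` the top row grows strictly with `s`. -/
theorem stairs_injective {r s r' s' : ℕ} (h : stairs r s = stairs r' s') : r = r' ∧ s = s' := by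
  have hlen := congrArg List.length h
  have hhead := congrArg (fun l => l.getD 0 0) h
  simp only [length_stairs] at hlen
  simp only [getD_stairs] at hhead
  split_ifs at hhead <;> omega

theorem sum_staircase (a : ℕ) :
    (staircase (2 * a)).sum = a ^ 2 + a ∧ (staircase (2 * a + 1)).sum = (a + 1) ^ 2 := by
  induction a with
  | zero => simp [staircase]
  | succ a ih =>
    have h1 : (staircase (2 * (a + 1))).sum = (a + 1) ^ 2 + (a + 1) := by
      rw [show 2 * (a + 1) = 2 * a + 1 + 1 by ring, staircase, List.sum_cons, ih.2,
        show (2 * a + 1) / 2 = a by omega]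
      ring
    refine ⟨h1, ?_⟩
    rw [staircase, List.sum_cons, h1, show 2 * (a + 1) / 2 = a + 1 by omega]
    ring

theorem sum_stairs (r s : ℕ) :
    (stairs r s).sum = (staircase r).sum + s * ((r + 1) / 2) + s * (s + 1) := by
  induction s with
  | zero => simp [stairs]
  | succ s ih => rw [stairs, List.sum_cons, ih]; ring

/-- The parts of the `3`-core whose first-column hooklengths are `1, 4, …, 3a - 2` and
`2, 5, …, 3b - 1`. -/
def coreParts (z : ℕ × ℕ) : List ℕ :=
  -- While both residue classes last, the hooklengths interlace and give the staircase; the rest of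
  -- the longer class has gaps `3`, hence row steps `2`. If `a > b`, the first extra hooklength `3b
  -- + 1` still extends the staircase.
  if z.1 ≤ z.2 then stairs (2 * z.1) (z.2 - z.1) else stairs (2 * z.2 + 1) (z.1 - z.2 - 1)

theorem sum_coreParts (z : ℕ × ℕ) : (coreParts z).sum + z.1 * z.2 = z.1 ^ 2 + z.2 ^ 2 + z.2 := by
  obtain ⟨a, b⟩ := z
  unfold coreParts
  simp only
  split_ifs with h
  · obtain ⟨s, rfl⟩ := Nat.exists_eq_add_of_le h
    rw [sum_stairs, (sum_staircase a).1, show (2 * a + 1) / 2 = a by omega,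
      show a + s - a = s by omega]
    ring
  · obtain ⟨s, rfl⟩ := Nat.exists_eq_add_of_lt (not_le.1 h)
    rw [sum_stairs, (sum_staircase b).2, show (2 * b + 1 + 1) / 2 = b + 1 by omega,
      show b + s + 1 - b - 1 = s by omega]
    ring

theorem coreParts_injective : Function.Injective coreParts := by
  rintro ⟨a, b⟩ ⟨a', b'⟩ h
  unfold coreParts at h
  simp only at h
  rw [Prod.mk.injEq]
  split_ifs at h <;> have := stairs_injective h <;> omega

theorem exists_coreParts_eq (r s : ℕ) : ∃ z, coreParts z = stairs r s := by
  rcases Nat.even_or_odd' r with ⟨a, rfl | rfl⟩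
  · exact ⟨(a, a + s), by simp [coreParts]⟩
  · refine ⟨(a + s + 1, a), ?_⟩
    rw [coreParts, if_neg (by simp only; omega)]
    simp only
    congr 1
    omega

theorem coreParts_eq_stairs (z : ℕ × ℕ) : ∃ r s, coreParts z = stairs r s := by
  unfold coreParts
  split_ifs
  · exact ⟨_, _, rfl⟩
  · exact ⟨_, _, rfl⟩

theorem isThreeCore_iff {n : ℕ} (p : n.Partition) :
    IsThreeCore p ↔ ∃ z, p.parts = ↑(coreParts z) := by
  have hsort := p.parts.pairwise_sort (· ≥ ·)
  rw [IsThreeCore, forall_hookLength_ne_three_iff,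
    show (diagram p).rowLen = fun i => (p.parts.sort (· ≥ ·)).getD i 0 from
      funext fun i => rowLen_ofRowLens_eq_getD _ _ i]
  constructor
  · intro h
    obtain ⟨r, s, hrs⟩ := exists_eq_stairs hsort
      (fun x hx => p.parts_pos ((Multiset.mem_sort _).1 hx)) h
    obtain ⟨z, hz⟩ := exists_coreParts_eq r s
    exact ⟨z, by rw [hz, ← hrs, Multiset.sort_eq]⟩
  · rintro ⟨z, hz⟩
    obtain ⟨r, s, hrs⟩ := coreParts_eq_stairs z
    rw [hz, hrs, Multiset.coe_sort, List.mergeSort_eq_self _ (pairwise_stairs r s)]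
    exact noThreeHook_stairs r s

/-- The `3`-core partitions of `n` are as many as the solutions of `a² - ab + b² + b = n` in
natural numbers. -/
theorem a₃_eq_ncard (n : ℕ) :
    a₃ n = {z : ℕ × ℕ | z.1 ^ 2 + z.2 ^ 2 + z.2 = n + z.1 * z.2}.ncard := by
  rw [a₃, ← Set.ncard_coe_finset]
  symm
  have hsum : ∀ z : ℕ × ℕ, z.1 ^ 2 + z.2 ^ 2 + z.2 = n + z.1 * z.2 → (coreParts z).sum = n := by
    intro z hz
    have := sum_coreParts z
    omega
  have hpos : ∀ z : ℕ × ℕ, ∀ x ∈ coreParts z, 0 < x := by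
    intro z x hx
    obtain ⟨r, s, hrs⟩ := coreParts_eq_stairs z
    rw [hrs] at hx
    exact (mem_stairs hx).1
  refine Set.ncard_congr
    (fun z hz => (⟨coreParts z, fun {x} hx => hpos z x (by simpa using hx), by
      simpa using hsum z hz⟩ : n.Partition)) ?_ ?_ ?_
  · intro z hz
    simp only [Finset.coe_filter, Finset.mem_univ, true_and, Set.mem_ofPred_eq]
    exact (isThreeCore_iff _).2 ⟨z, rfl⟩
  · intro z w hz hw h
    have h' := congrArg Nat.Partition.parts h
    simp only [Multiset.coe_eq_coe] at h'
    obtain ⟨r, s, hrs⟩ := coreParts_eq_stairs z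
    obtain ⟨r', s', hrs'⟩ := coreParts_eq_stairs w
    refine coreParts_injective (h'.eq_of_pairwise' (r := (· ≥ ·)) ?_ ?_)
    · rw [hrs]; exact pairwise_stairs r s
    · rw [hrs']; exact pairwise_stairs r' s'
  · intro p hp
    simp only [Finset.coe_filter, Finset.mem_univ, true_and, Set.mem_ofPred_eq] at hp
    obtain ⟨z, hz⟩ := (isThreeCore_iff p).1 hp
    refine ⟨z, ?_, Nat.Partition.ext hz.symm⟩
    have h1 := sum_coreParts z
    have h2 := p.parts_sum
    rw [hz, Multiset.sum_coe] at h2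
    simp only [Set.mem_ofPred_eq]
    omega

/-! ### From 3-cores to Eisenstein integers -/

/-- Up to multiplication by the six units, the Eisenstein integers of norm `3n + 1` are as many as
the `3`-cores of `n`. -/
theorem ncard_normSet_eq (n : ℕ) : (normSet (3 * n + 1 : ℕ)).ncard = 6 * a₃ n := by
  set E := normSet (3 * n + 1 : ℕ) with hE
  have hfin : ∀ s : Set (ℤ × ℤ), s ⊆ E → s.Finite := fun s hs => (normSet_finite _).subset hs
  -- Three sectors permuted by `ω`. Strict inequalities lose nothing: on the boundary lines `x =
  -- 2y`, `y = 2x`, `x + y = 0` the sum `x + y` is divisible by `3`.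
  set D₀ := {z ∈ E | (z.1 + z.2) % 3 = 1 ∧ 2 * z.2 < z.1 ∧ z.2 < 2 * z.1} with hD₀
  set D₁ := {z ∈ E | (z.1 + z.2) % 3 = 1 ∧ 2 * z.1 < z.2 ∧ z.1 + z.2 < 0} with hD₁
  set D₂ := {z ∈ E | (z.1 + z.2) % 3 = 1 ∧ 0 < z.1 + z.2 ∧ z.1 < 2 * z.2} with hD₂
  set F₁ := {z ∈ E | (z.1 + z.2) % 3 = 1} with hF₁
  set F₂ := {z ∈ E | (z.1 + z.2) % 3 = 2} with hF₂
  -- The norm is `(x + y)² - 3xy`, so `3 ∣ x + y` would contradict norm `3n + 1`.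
  have hmod : ∀ z ∈ E, (z.1 + z.2) % 3 = 1 ∨ (z.1 + z.2) % 3 = 2 := by
    rintro ⟨x, y⟩ h
    rw [hE, mem_normSet] at h
    simp only at h ⊢
    by_contra! hne
    obtain ⟨j, hj⟩ : (3 : ℤ) ∣ x + y := by omega
    obtain rfl : x = 3 * j - y := by linarith
    push_cast at h
    have : (3 : ℤ) * (3 * j ^ 2 - 3 * j * y + y ^ 2 - n) = 1 := by linear_combination h
    omega
  have h0 : D₀.ncard = a₃ n := by
    rw [a₃_eq_ncard]
    symm
    -- The witness solves `x - 2y = 3a + 1`, `2x - y = 3b + 2`; the sector makes both left sides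
    -- positive, and `x + y ≡ 1` fixes their residues.
    refine Set.ncard_congr (fun z _ => (2 * (z.2 : ℤ) - z.1 + 1, (z.2 : ℤ) - 2 * z.1)) ?_ ?_ ?_
    · rintro ⟨a, b⟩ h
      simp only [Set.mem_ofPred_eq] at h
      refine ⟨?_, ?_, ?_, ?_⟩
      · have h' : (a : ℤ) ^ 2 + b ^ 2 + b = n + a * b := by exact_mod_cast h
        rw [hE, mem_normSet]
        push_cast
        linear_combination 3 * h'
      all_goals simp only; omega
    · rintro ⟨a, b⟩ ⟨a', b'⟩ - - h
      simp only [Prod.mk.injEq] at h ⊢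
      omega
    · rintro ⟨x, y⟩ ⟨h, hm, h1, h2⟩
      simp only at hm h1 h2
      obtain ⟨a, ha⟩ : ∃ a : ℕ, x - 2 * y = 3 * a + 1 := ⟨((x - 2 * y) / 3).toNat, by omega⟩
      obtain ⟨b, hb⟩ : ∃ b : ℕ, 2 * x - y = 3 * b + 2 := ⟨((2 * x - y) / 3).toNat, by omega⟩
      have hx : x = 2 * b - a + 1 := by omega
      have hy : y = b - 2 * a := by omega
      subst hx hy
      refine ⟨(a, b), ?_, rfl⟩
      rw [hE, mem_normSet] at h
      push_cast at h
      have h' : (a : ℤ) ^ 2 + b ^ 2 + b = n + a * b := by linarith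
      exact_mod_cast h'
  have hrot : D₁.ncard = D₀.ncard := by
    -- Multiplication by `ω`; for `D₂` below it is by `ω²`.
    refine Set.ncard_congr (fun z _ => (-z.2, z.1 - z.2)) ?_ ?_ ?_
    · rintro ⟨x, y⟩ ⟨h, h1, h2, h3⟩
      rw [hE, mem_normSet] at h
      simp only at h h1 h2 h3
      refine ⟨?_, ?_, ?_, ?_⟩
      · rw [hE, mem_normSet]; linear_combination h
      all_goals simp only; omega
    · rintro ⟨x, y⟩ ⟨x', y'⟩ - - h
      simp only [Prod.mk.injEq] at h ⊢
      omega
    · rintro ⟨x, y⟩ ⟨h, h1, h2, h3⟩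
      rw [hE, mem_normSet] at h
      simp only at h h1 h2 h3
      refine ⟨(y - x, -x), ⟨?_, ?_, ?_, ?_⟩, by simp⟩
      · rw [hE, mem_normSet]; linear_combination h
      all_goals simp only; omega
  have hrot' : D₂.ncard = D₀.ncard := by
    refine Set.ncard_congr (fun z _ => (z.2 - z.1, -z.1)) ?_ ?_ ?_
    · rintro ⟨x, y⟩ ⟨h, h1, h2, h3⟩
      rw [hE, mem_normSet] at h
      simp only at h h1 h2 h3
      refine ⟨?_, ?_, ?_, ?_⟩
      · rw [hE, mem_normSet]; linear_combination h
      all_goals simp only; omega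
    · rintro ⟨x, y⟩ ⟨x', y'⟩ - - h
      simp only [Prod.mk.injEq] at h ⊢
      omega
    · rintro ⟨x, y⟩ ⟨h, h1, h2, h3⟩
      rw [hE, mem_normSet] at h
      simp only at h h1 h2 h3
      refine ⟨(-y, x - y), ⟨?_, ?_, ?_, ?_⟩, by simp⟩
      · rw [hE, mem_normSet]; linear_combination h
      all_goals simp only; omega
  have hneg : F₂.ncard = F₁.ncard := by
    refine Set.ncard_congr (fun z _ => (-z.1, -z.2)) ?_ ?_ ?_
    · rintro ⟨x, y⟩ ⟨h, h1⟩
      rw [hE, mem_normSet] at h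
      simp only at h h1
      refine ⟨?_, ?_⟩
      · rw [hE, mem_normSet]; linear_combination h
      · simp only; omega
    · rintro ⟨x, y⟩ ⟨x', y'⟩ - - h
      simp only [Prod.mk.injEq] at h ⊢
      omega
    · rintro ⟨x, y⟩ ⟨h, h1⟩
      rw [hE, mem_normSet] at h
      simp only at h h1
      refine ⟨(-x, -y), ⟨?_, ?_⟩, by simp⟩
      · rw [hE, mem_normSet]; linear_combination h
      · simp only; omega
  have hF : F₁ = (D₀ ∪ D₁) ∪ D₂ := by
    ext ⟨x, y⟩
    simp only [hF₁, hD₀, hD₁, hD₂, Set.mem_union, Set.mem_ofPred_eq]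
    constructor
    · rintro ⟨h, h1⟩
      simp only [h, h1, true_and]
      omega
    · rintro ((⟨h, h1, -⟩ | ⟨h, h1, -⟩) | ⟨h, h1, -⟩) <;> exact ⟨h, h1⟩
  have hEF : E = F₁ ∪ F₂ := by
    ext z
    constructor
    · intro h
      exact (hmod z h).imp (fun h' => ⟨h, h'⟩) fun h' => ⟨h, h'⟩
    · rintro (h | h) <;> exact h.1
  have hd : Disjoint D₀ D₁ := by
    rw [Set.disjoint_left]
    rintro ⟨x, y⟩ ⟨-, -, h1, h2⟩ ⟨-, -, h3, h4⟩
    simp only at h1 h2 h3 h4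
    omega
  have hd' : Disjoint (D₀ ∪ D₁) D₂ := by
    rw [Set.disjoint_left]
    rintro ⟨x, y⟩ (⟨-, -, h1, h2⟩ | ⟨-, -, h1, h2⟩) ⟨-, -, h3, h4⟩ <;>
    · simp only at h1 h2 h3 h4
      omega
  have hdF : Disjoint F₁ F₂ := by
    rw [Set.disjoint_left]
    rintro z ⟨-, h1⟩ ⟨-, h2⟩
    omega
  rw [hEF, Set.ncard_union_eq hdF (hfin _ fun _ h => h.1) (hfin _ fun _ h => h.1), hneg, hF,
    Set.ncard_union_eq hd' ((hfin _ fun _ h => h.1).union (hfin _ fun _ h => h.1))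
      (hfin _ fun _ h => h.1),
    Set.ncard_union_eq hd (hfin _ fun _ h => h.1) (hfin _ fun _ h => h.1), hrot, hrot', h0]
  ring

/-! ### Multiplying the norm by `k` -/

/-- The ratio `(ν_p(k) + ν_p(M) + 1) / (ν_p(M) + 1)`. -/
def valuationRatio (k M p : ℕ) : ℚ :=
  ((padicValNat p k + padicValNat p M + 1 : ℕ) : ℚ) / ((padicValNat p M + 1 : ℕ) : ℚ)

theorem valuationRatio_of_not_dvd {k p : ℕ} (M : ℕ) (h : ¬ p ∣ k) : valuationRatio k M p = 1 := by
  rw [valuationRatio, padicValNat.eq_zero_of_not_dvd h, zero_add]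
  exact div_self (Nat.cast_ne_zero.2 (Nat.succ_ne_zero _))

/-- Telescoping: the numerator for `l` at `M` is the denominator for `k` at `l * M`. -/
theorem valuationRatio_mul {k l M p : ℕ} (hp : p.Prime) (hk : 0 < k) (hl : 0 < l) (hM : 0 < M) :
    valuationRatio (k * l) M p = valuationRatio l M p * valuationRatio k (l * M) p := by
  have : Fact p.Prime := ⟨hp⟩
  simp only [valuationRatio, padicValNat.mul hk.ne' hl.ne', padicValNat.mul hl.ne' hM.ne']
  have h1 : ((padicValNat p l + padicValNat p M + 1 : ℕ) : ℚ) ≠ 0 :=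
    Nat.cast_ne_zero.2 (Nat.succ_ne_zero _)
  have h2 : ((padicValNat p M + 1 : ℕ) : ℚ) ≠ 0 := Nat.cast_ne_zero.2 (Nat.succ_ne_zero _)
  field_simp
  push_cast
  ring

theorem mulSupport_valuationRatio_finite {k : ℕ} (hk : 0 < k) (M : ℕ) :
    (Function.mulSupport fun p : primesOneModThree => valuationRatio k M p).Finite := by
  refine (k.primeFactors.finite_toSet.preimage
    (Subtype.val_injective (p := (· ∈ primesOneModThree))).injOn).subset fun p hp => ?_
  rw [Set.mem_preimage, Finset.mem_coe, Nat.mem_primeFactors]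
  refine ⟨p.2.1, ?_, hk.ne'⟩
  by_contra h
  exact hp (valuationRatio_of_not_dvd M h)

/-- Multiplication of `M` by `k` multiplies the number of Eisenstein integers of norm `M` by the
ratios `valuationRatio k M p`. -/
def ScalesNormCount (k : ℕ) : Prop :=
  0 < k ∧ k ≡ 1 [MOD 3] ∧ ∀ M : ℕ, 0 < M → ((normSet (k * M : ℕ)).ncard : ℚ) =
    (normSet M).ncard * ∏ᶠ p : primesOneModThree, valuationRatio k M p

namespace ScalesNormCount

theorem one : ScalesNormCount 1 := by
  refine ⟨one_pos, rfl, fun M _ => ?_⟩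
  rw [one_mul, finprod_eq_one_of_forall_eq_one, mul_one]
  exact fun p => valuationRatio_of_not_dvd M fun h => p.2.1.one_lt.ne' (Nat.dvd_one.1 h)

theorem mul {k l : ℕ} (hk : ScalesNormCount k) (hl : ScalesNormCount l) :
    ScalesNormCount (k * l) := by
  refine ⟨Nat.mul_pos hk.1 hl.1, hk.2.1.mul hl.2.1, fun M hM => ?_⟩
  rw [mul_assoc, hk.2.2 _ (Nat.mul_pos hl.1 hM), hl.2.2 M hM, mul_assoc,
    ← finprod_mul_distrib (mulSupport_valuationRatio_finite hl.1 M)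
      (mulSupport_valuationRatio_finite hk.1 (l * M))]
  congr 1
  exact finprod_congr fun p => (valuationRatio_mul p.2.1 hk.1 hl.1 hM).symm

theorem of_split {p : ℕ} (hp : p.Prime) (h1 : p ≡ 1 [MOD 3]) : ScalesNormCount p := by
  have : Fact p.Prime := ⟨hp⟩
  refine ⟨hp.pos, h1, fun M hM => ?_⟩
  rw [finprod_eq_single _ (⟨p, hp, h1⟩ : primesOneModThree) fun q hq =>
    valuationRatio_of_not_dvd M fun h => hq (Subtype.ext ((Nat.prime_dvd_prime_iff_eq q.2.1 hp).1 h))]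
  have h := ncard_normSet_split_mul hp h1 hM
  have h' : ((normSet (p * M : ℕ)).ncard : ℚ) * (padicValNat p M + 1) =
      (normSet M).ncard * (padicValNat p M + 2) := by exact_mod_cast h
  have h2 : (padicValNat p M : ℚ) + 1 ≠ 0 := by positivity
  rw [valuationRatio, padicValNat_self]
  push_cast at h' ⊢
  rw [← mul_div_assoc, eq_div_iff h2]
  linear_combination h'

theorem of_inert {q : ℕ} (hq : q.Prime) (h2 : q ≡ 2 [MOD 3]) : ScalesNormCount (q * q) := by
  refine ⟨Nat.mul_pos hq.pos hq.pos, h2.mul h2, fun M _ => ?_⟩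
  rw [ncard_normSet_inert_sq_mul hq h2, finprod_eq_one_of_forall_eq_one, mul_one]
  refine fun p => valuationRatio_of_not_dvd M fun h => ?_
  have hpq := (Nat.prime_dvd_prime_iff_eq p.2.1 hq).1 ((p.2.1.dvd_mul.1 h).elim id id)
  have hp := p.2.2
  rw [hpq] at hp
  exact absurd (hp.symm.trans h2) (by decide)

theorem prod {l : List ℕ} (h : ∀ k ∈ l, ScalesNormCount k) : ScalesNormCount l.prod := by
  induction l with
  | nil => exact one
  | cons k l ih =>
    rw [List.prod_cons]
    exact (h k List.mem_cons_self).mul (ih fun j hj => h j (List.mem_cons_of_mem _ hj))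

theorem sq {s : ℕ} (hs : s ≠ 0) (h : ∀ q : ℕ, q.Prime → q ∣ s → q ≡ 2 [MOD 3]) :
    ScalesNormCount (s * s) := by
  have h' := prod (l := s.primeFactorsList.map fun q => q * q) fun k hk => by
    obtain ⟨q, hq, rfl⟩ := List.mem_map.1 hk
    have hq' := Nat.prime_of_mem_primeFactorsList hq
    exact of_inert hq' (h q hq' (Nat.dvd_of_mem_primeFactorsList hq))
  rwa [List.prod_map_mul, List.map_id', Nat.prod_primeFactorsList hs] at h'

theorem of_isSquare_twoModThreePart {k : ℕ} (hk : 0 < k) (h3 : ¬ 3 ∣ k)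
    (h : IsSquare (twoModThreePart k)) : ScalesNormCount k := by
  have hprod : twoModThreePart k * (k.primeFactorsList.filter fun p => ¬ p ≡ 2 [MOD 3]).prod = k := by
    have := Multiset.prod_filter_mul_prod_filter_not (s := (k.primeFactorsList : Multiset ℕ))
      (fun p => p ≡ 2 [MOD 3])
    rw [Multiset.prod_coe, Nat.prod_primeFactorsList hk.ne'] at this
    simpa [twoModThreePart] using this
  rw [← hprod]
  refine mul ?_ (prod fun p hp => ?_)
  · obtain ⟨s, hs⟩ := h
    rw [hs]
    refine sq (fun h0 => ?_) fun q hq hqs => ?_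
    · rw [hs, h0] at hprod
      omega
    · have hd : q ∣ twoModThreePart k := hs ▸ hqs.mul_right s
      obtain ⟨p, hp, hqp⟩ := (Nat.prime_iff.1 hq).dvd_prod_iff.1 hd
      rw [List.mem_filter] at hp
      rw [(Nat.prime_dvd_prime_iff_eq hq (Nat.prime_of_mem_primeFactorsList hp.1)).1 hqp]
      exact of_decide_eq_true hp.2
  · rw [List.mem_filter] at hp
    have hpr := Nat.prime_of_mem_primeFactorsList hp.1
    have h2 : ¬ p % 3 = 2 := of_decide_eq_true hp.2
    refine of_split hpr (show p % 3 = 1 from ?_)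
    have h0 : ¬ p % 3 = 0 := fun h0 => h3
      ((Nat.dvd_of_mod_eq_zero h0).trans (Nat.dvd_of_mem_primeFactorsList hp.1))
    omega

theorem a₃_eq {k : ℕ} (h : ScalesNormCount k) (n : ℕ) :
    (a₃ (k * n + (k - 1) / 3) : ℚ) = a₃ n * ∏ᶠ p : primesOneModThree, factor k n p := by
  have hk : k % 3 = 1 := h.2.1
  have harg : 3 * (k * n + (k - 1) / 3) + 1 = k * (3 * n + 1) := by
    have : 3 * ((k - 1) / 3) + 1 = k := by omega
    linear_combination this
  have h' := h.2.2 (3 * n + 1) (Nat.succ_pos _)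
  rw [← harg, ncard_normSet_eq, ncard_normSet_eq] at h'
  push_cast at h'
  have h6 : (6 : ℚ) ≠ 0 := by norm_num
  apply mul_left_cancel₀ h6
  rw [h', mul_assoc]
  -- `factor k n p` unfolds to `valuationRatio k (3 * n + 1) p`.
  rfl

end ScalesNormCount

end ThreeCore

theorem mainTheorem5 (k : ℕ) (hk : 0 < k) (h3 : ¬ 3 ∣ k) :
    (IsSquare (ThreeCore.twoModThreePart k) →
      k ≡ 1 [MOD 3] ∧
      ∀ n : ℕ,
        (Function.mulSupport
          fun p : ThreeCore.primesOneModThree => ThreeCore.factor k n p).Finite ∧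
        (ThreeCore.a₃ (k * n + (k - 1) / 3) : ℚ) =
          (ThreeCore.a₃ n : ℚ) *
            ∏ᶠ p : ThreeCore.primesOneModThree, ThreeCore.factor k n p) ∧
    (IsSquare k → (∀ p : ℕ, p.Prime → p ∣ k → ¬ p ≡ 1 [MOD 3]) →
      k ≡ 1 [MOD 3] ∧
      ∀ n : ℕ, ThreeCore.a₃ (k * n + (k - 1) / 3) = ThreeCore.a₃ n) := by
  refine ⟨fun hsq => ?_, fun hsq hp => ?_⟩
  · have h := ThreeCore.ScalesNormCount.of_isSquare_twoModThreePart hk h3 hsq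
    exact ⟨h.2.1, fun n =>
      ⟨ThreeCore.mulSupport_valuationRatio_finite hk (3 * n + 1), h.a₃_eq n⟩⟩
  -- Every prime factor of the square root of `k` is `≡ 2` modulo `3`, so inert squares alone
  -- suffice, and all ratios are `1`.
  · have h : ThreeCore.ScalesNormCount k := by
      obtain ⟨s, rfl⟩ := hsq
      refine ThreeCore.ScalesNormCount.sq (by rintro rfl; simp at hk) fun q hq hqs => ?_
      have h1 : ¬ q % 3 = 1 := hp q hq (hqs.mul_right s)
      have h0 : ¬ q % 3 = 0 := fun h0 => h3
        ((Nat.dvd_of_mod_eq_zero h0).trans (hqs.mul_right s))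
      show q % 3 = 2
      omega
    refine ⟨h.2.1, fun n => ?_⟩
    have h' := h.a₃_eq n
    rw [finprod_eq_one_of_forall_eq_one, mul_one] at h'
    · exact_mod_cast h'
    · exact fun p =>
        ThreeCore.valuationRatio_of_not_dvd (3 * n + 1) fun hd => hp p p.2.1 hd p.2.2
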